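/- Let $n\ge 1$ and let $\Omega$ be a compact $(n+1)$-dimensional smooth manifold with corners whose boundary is $\partial\Omega=Y\cup\Sigma_0\cup\Sigma_1$, where $Y,\Sigma_0,\Sigma_1$ are closed subsets, $\Sigma_0\cap\Sigma_1=\emptyset$, and $M_0=Y\cap\Sigma_0$, $M_1=Y\cap\Sigma_1$ are non-empty. Assume that every point of $\Omega$ has a neighbourhood with smooth coordinates identifying it with an open subset of $\mathbb{R}^{n-1}\times[0,\infty)^2$ in which $Y$ is given by the vanishing of one of the two half-line coordinates and $\Sigma_0\cup\Sigma_1$ by the vanishing of the other; thus $(\Omega,Y)$ is a cobordism between the $n$-dimensional manifolds with boundary $(\Sigma_0,M_0)$ and $(\Sigma_1,M_1)$. (Orientability is not needed.) Fix a smooth Riemannian metric on $\Omega$, and let $F\colon\Omega\to[0,1]$ be a Morse function on the cobordism: $F$ is smooth, $F|_{\Sigma_0}=0$, $F|_{\Sigma_1}=1$, all critical points of $F$ are non-degenerate, none of them lies on $\Sigma_0\cup\Sigma_1$, and $\nabla F$ is tangent to $Y$ at every point of $Y$. Suppose that $F$ has exactly one critical point $z$ in $\Omega$ and that $z$ lies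 in the interior, $z\notin Y$. Let $\Sigma'$ be the connected component containing $z$ of the critical level set $F^{-1}(F(z))$. If $\Sigma_0$, $\Sigma_1$ and $\Omega$ have no closed connected components (that is, every connected component of $\Sigma_0$, of $\Sigma_1$ and of $\Omega$ meets $M_0$, $M_1$ and $\partial\Omega$ respectively), then $$\Sigma'\cap Y\neq\emptyset .$$ In other words, for such a function $F$ the condition ``the connected component of $F^{-1}(F(z))$ containing $z$ has non-empty intersection with $Y$'' holds automatically and need not be assumed. -/

import Mathlib

open Set
open scoped Manifold ContDiff

noncomputable section

/-- The standard model of `(n+1)`-dimensional manifolds with corners. -/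
abbrev cornerModel (n : ℕ) :
    ModelWithCorners ℝ (EuclideanSpace ℝ (Fin (n + 1))) (EuclideanQuadrant (n + 1)) :=
  modelWithCornersEuclideanQuadrant (n + 1)

/-- A cobordism `(Ω, Y)` between the `n`-dimensional manifolds with boundary `(S₀, Y ∩ S₀)` and
`(S₁, Y ∩ S₁)`, on a given `(n+1)`-dimensional manifold with corners `Ω` (where `1 ≤ n`).
Compactness of `Ω` is supplied by the instance `CompactSpace Ω` wherever cobordisms are used. -/
structure Cobordism (n : ℕ) (Ω : Type*) [TopologicalSpace Ω]
    [ChartedSpace (EuclideanQuadrant (n + 1)) Ω] where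
  /-- The vertical part of the boundary. -/
  Y : Set Ω
  /-- The incoming end. -/
  S₀ : Set Ω
  /-- The outgoing end. -/
  S₁ : Set Ω
  isClosed_Y : IsClosed Y
  isClosed_S₀ : IsClosed S₀
  isClosed_S₁ : IsClosed S₁
  disjoint_ends : Disjoint S₀ S₁
  boundary_eq : (cornerModel n).boundary Ω = Y ∪ S₀ ∪ S₁
  /-- `M₀ = ∂ S₀` is non-empty. -/
  nonempty_M₀ : (Y ∩ S₀).Nonempty
  /-- `M₁ = ∂ S₁` is non-empty. -/
  nonempty_M₁ : (Y ∩ S₁).Nonempty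
  /-- Around every point `Ω` looks like an open subset of `ℝ^(n-1) × [0,∞)²`, one of the two
  half-line coordinates cutting out `Y` and the other one cutting out `S₀ ∪ S₁`. In particular
  `Y`, `S₀`, `S₁` are smooth hypersurfaces with boundary, meeting in corners along the
  `Y ∩ Sᵢ`, and `∂Sᵢ = Y ∩ Sᵢ`. Around a point off one of these hypersurfaces, the corresponding
  coordinate is positive on the whole domain of a small enough chart. -/
  exists_chart : ∀ p : Ω, ∃ φ ∈ IsManifold.maximalAtlas (cornerModel n) ∞ Ω, p ∈ φ.source ∧
    ∀ q ∈ φ.source,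
      (q ∈ Y ↔ (φ q).1 0 = 0) ∧ (q ∈ S₀ ∪ S₁ ↔ (φ q).1 (Fin.last n) = 0) ∧
      ∀ i : Fin (n + 1), i ≠ 0 → i ≠ Fin.last n → 0 < (φ q).1 i

/-- `v` is tangent at `p` to the hypersurface `Y`: in charts in which `Y` is given by the vanishing
of the first coordinate, the first coordinate of `v` vanishes. -/
def IsTangentAt {n : ℕ} {Ω : Type*} [TopologicalSpace Ω]
    [ChartedSpace (EuclideanQuadrant (n + 1)) Ω] (Y : Set Ω) (p : Ω)
    (v : TangentSpace (cornerModel n) p) : Prop :=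
  ∀ φ ∈ IsManifold.maximalAtlas (cornerModel n) ∞ Ω, p ∈ φ.source →
    (∀ q ∈ φ.source, q ∈ Y ↔ (φ q).1 0 = 0) →
    mfderiv (cornerModel n) 𝓘(ℝ, ℝ) (fun q => (φ q).1 0) p v = (0 : ℝ)

/-- The points at which the differential of `F` vanishes. -/
def criticalSet (n : ℕ) {Ω : Type*} [TopologicalSpace Ω]
    [ChartedSpace (EuclideanQuadrant (n + 1)) Ω] (F : Ω → ℝ) : Set Ω :=
  {p | mfderiv (cornerModel n) 𝓘(ℝ, ℝ) F p = 0}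

/-- The matrix of second derivatives of `F` at `p` in the preferred chart at `p`, as a bilinear
form. At a critical point, its non-degeneracy does not depend on the chart. -/
def chartHessian (n : ℕ) {Ω : Type*} [TopologicalSpace Ω]
    [ChartedSpace (EuclideanQuadrant (n + 1)) Ω] (F : Ω → ℝ) (p : Ω) :
    EuclideanSpace ℝ (Fin (n + 1)) →L[ℝ] EuclideanSpace ℝ (Fin (n + 1)) →L[ℝ] ℝ :=
  fderivWithin ℝ
    (fderivWithin ℝ (F ∘ (extChartAt (cornerModel n) p).symm) (range (cornerModel n)))
    (range (cornerModel n)) (extChartAt (cornerModel n) p p)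

/-- Smooth Riemannian metrics on `Ω`. -/
abbrev SmoothMetric (n : ℕ) (Ω : Type*) [TopologicalSpace Ω]
    [ChartedSpace (EuclideanQuadrant (n + 1)) Ω] [IsManifold (cornerModel n) ∞ Ω] :=
  letI : IsManifold (cornerModel n) 1 Ω := IsManifold.of_le (n := ∞) (by simp)
  Bundle.ContMDiffRiemannianMetric (cornerModel n) ∞ (EuclideanSpace ℝ (Fin (n + 1)))
    (fun p : Ω => TangentSpace (cornerModel n) p)

/-- `v` is the gradient of `F` at `p` with respect to the metric `g`. -/
def IsGradientAt {n : ℕ} {Ω : Type*} [TopologicalSpace Ω]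
    [ChartedSpace (EuclideanQuadrant (n + 1)) Ω] [IsManifold (cornerModel n) ∞ Ω]
    (g : SmoothMetric n Ω) (F : Ω → ℝ) (p : Ω) (v : TangentSpace (cornerModel n) p) : Prop :=
  ∀ w : TangentSpace (cornerModel n) p,
    g.inner p v w = (mfderiv (cornerModel n) 𝓘(ℝ, ℝ) F p w : ℝ)

/-- `F` is a Morse function on the cobordism `W`, with respect to the Riemannian metric `g`. -/
structure IsMorseFunction {n : ℕ} {Ω : Type*} [TopologicalSpace Ω]
    [ChartedSpace (EuclideanQuadrant (n + 1)) Ω] [IsManifold (cornerModel n) ∞ Ω]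
    (W : Cobordism n Ω) (g : SmoothMetric n Ω) (F : Ω → ℝ) : Prop where
  smooth : ContMDiff (cornerModel n) 𝓘(ℝ, ℝ) ∞ F
  mem_Icc : ∀ p, F p ∈ Icc (0 : ℝ) 1
  eq_zero : ∀ p ∈ W.S₀, F p = 0
  eq_one : ∀ p ∈ W.S₁, F p = 1
  nondegenerate : ∀ p ∈ criticalSet n F, ∀ v, (∀ w, chartHessian n F p v w = 0) → v = 0
  not_critical : ∀ p ∈ W.S₀ ∪ W.S₁, p ∉ criticalSet n F
  gradient_tangent : ∀ p ∈ W.Y, ∃ v, IsGradientAt g F p v ∧ IsTangentAt W.Y p v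

/-- The manifold `S`, whose boundary is `S ∩ B`, has no closed connected component: every connected
component of `S` meets `B`. -/
def NoClosedComponent {Ω : Type*} [TopologicalSpace Ω] (S B : Set Ω) : Prop :=
  ∀ p ∈ S, (connectedComponentIn S p ∩ B).Nonempty

end

/-!
The flow of the gradient would retract `Ω` onto the critical level `L = F ⁻¹' {F z}`; the argument
below keeps the topological content of that retraction and avoids flows.

Suppose that the component of `z` in `L` misses `Y`. In the compact Hausdorff space `L` components
are intersections of clopen sets, so `L` has a clopen subset `V` containing `z` and disjoint from
`Y`. It is spread over the bands `{F z ≤ F ≤ s}` as a relatively clopen set which is still disjoint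
from `Y` (`IsBandSplitting`), by real induction on `s`. Passing to a slightly higher `s` is a
separation argument for compact sets (`IsBandSplitting.exists_gt`), which also works at the critical
level. At a limit value of `s` one takes closures (`IsBandSplitting.exists_of_forall_lt`); this
needs that `F` looks like a projection just below each point `p` of the new level, in the weak sense that
small neighbourhoods of `p` have connected intersection with `{F < F p}`, and that `Y` reaches `p`
from below if `p ∈ Y` (`IsRegularFromBelow`). The same is done below the critical level with `-F`.
Together the two pieces form a clopen subset of `Ω` which contains `z` and misses `Y`. But the
component of `z` in `Ω` meets the boundary, hence `Y`, or one of the ends and then, as the ends have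
no closed components, again `Y`: a contradiction.

Regularity at a point `p ≠ z` is checked in a chart. It suffices to have a direction `w` in which
`F` decreases and along which one stays in the quadrant, and in `Y` if `p ∈ Y`: sliding along `w`
then contracts the sublevel set near `p` to a convex cross-section
(`exists_isPreconnected_sublevel`). On an end `w` is the inward coordinate direction, on
`Y` it is the gradient up to sign, elsewhere any direction of decrease will do
(`Cobordism.isRegularFromBelow`).
-/

open Filter Topology

/-! ### Clopen subsets of bands between two levels -/

/-- `U` is a relatively clopen subset of the band `{c ≤ F ≤ s}` which extends the subset `V` of the
level `{F = c}` and is disjoint from `Y`. Relative clopenness is expressed by closedness of `U` and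
of its complement in the band. -/
structure IsBandSplitting {X : Type*} [TopologicalSpace X] (F : X → ℝ) (Y V : Set X) (c s : ℝ)
    (U : Set X) : Prop where
  subset : U ⊆ F ⁻¹' Icc c s
  isClosed : IsClosed U
  isClosed_diff : IsClosed (F ⁻¹' Icc c s \ U)
  level : U ∩ F ⁻¹' {c} = V
  disjoint : Disjoint U Y

namespace IsBandSplitting

variable {X : Type*} [TopologicalSpace X] {F : X → ℝ} {Y V : Set X} {c s t : ℝ} {U U' : Set X}

theorem mem_iff_of_level (h : IsBandSplitting F Y V c s U) {p : X} (hp : F p = c) :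
    p ∈ U ↔ p ∈ V := by
  rw [← h.level]; simp [hp]

theorem restrict (hF : Continuous F) (h : IsBandSplitting F Y V c t U) (hcs : c ≤ s) (hst : s ≤ t) :
    IsBandSplitting F Y V c s (U ∩ F ⁻¹' Iic s) where
  subset p hp := ⟨(h.subset hp.1).1, hp.2⟩
  isClosed := h.isClosed.inter (isClosed_Iic.preimage hF)
  isClosed_diff := by
    have : F ⁻¹' Icc c s \ (U ∩ F ⁻¹' Iic s) = (F ⁻¹' Icc c t \ U) ∩ F ⁻¹' Iic s := by
      ext p
      simp only [Set.mem_sdiff, mem_inter_iff, mem_preimage, mem_Icc, mem_Iic]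
      constructor
      · rintro ⟨⟨h1, h2⟩, h3⟩
        exact ⟨⟨⟨h1, h2.trans hst⟩, fun h => h3 ⟨h, h2⟩⟩, h2⟩
      · rintro ⟨⟨⟨h1, h2⟩, h3⟩, h4⟩
        exact ⟨⟨h1, h4⟩, fun h => h3 h.1⟩
    rw [this]
    exact h.isClosed_diff.inter (isClosed_Iic.preimage hF)
  level := by
    rw [← h.level]
    ext p
    simp only [mem_inter_iff, mem_preimage, mem_Iic, mem_singleton_iff]
    exact ⟨fun h => ⟨h.1.1, h.2⟩, fun h => ⟨⟨h.1, h.2.le.trans hcs⟩, h.2⟩⟩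
  disjoint := h.disjoint.mono_left inter_subset_left

/-- Splittings are unique: at a lowest point of `U \ U'` the function `F` would have a local
minimum. -/
theorem subset_of_forall_mem_closure [CompactSpace X] (hF : Continuous F)
    (hreg : ∀ p, c < F p → p ∈ closure {q | F q < F p})
    (h : IsBandSplitting F Y V c s U) (h' : IsBandSplitting F Y V c s U') : U ⊆ U' := by
  by_contra hne
  have hD : IsClosed (U ∩ (F ⁻¹' Icc c s \ U')) := h.isClosed.inter h'.isClosed_diff
  obtain ⟨q, hqU, hqU'⟩ := not_subset.1 hne
  obtain ⟨p, ⟨hpU, hpb, hpU'⟩, hmin⟩ := hD.isCompact.exists_isMinOn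
    ⟨q, hqU, h.subset hqU, hqU'⟩ hF.continuousOn
  have hcp : c < F p := lt_of_le_of_ne hpb.1 fun he =>
    hpU' ((h'.mem_iff_of_level he.symm).2 ((h.mem_iff_of_level he.symm).1 hpU))
  have hO : ((F ⁻¹' Icc c s \ U)ᶜ ∩ U'ᶜ) ∩ F ⁻¹' Ioi c ∈ 𝓝 p :=
    (((h.isClosed_diff.isOpen_compl).inter h'.isClosed.isOpen_compl).inter
      (isOpen_Ioi.preimage hF)).mem_nhds ⟨⟨fun hn => hn.2 hpU, hpU'⟩, hcp⟩
  obtain ⟨r, ⟨⟨hr1, hr2⟩, hr3⟩, hr⟩ := mem_closure_iff_nhds.1 (hreg p hcp) _ hO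
  have hrb : r ∈ F ⁻¹' Icc c s := ⟨le_of_lt hr3, (le_of_lt hr).trans hpb.2⟩
  have hrU : r ∈ U := by
    by_contra hrU
    exact hr1 ⟨hrb, hrU⟩
  exact absurd (isMinOn_iff.1 hmin r ⟨hrU, hrb, hr2⟩) (not_le.2 hr)

/-- A splitting persists on a slightly larger band, by separating its two closed parts by open
sets. -/
theorem exists_gt [CompactSpace X] [T2Space X] (hF : Continuous F) (hY : IsClosed Y) (hcs : c ≤ s)
    (h : IsBandSplitting F Y V c s U) :
    ∃ t > s, ∃ U', IsBandSplitting F Y V c t U' := by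
  have hdisj : Disjoint U ((F ⁻¹' Icc c s \ U) ∪ Y) :=
    disjoint_union_right.2 ⟨disjoint_sdiff_right, h.disjoint⟩
  obtain ⟨O, O', hO, hO', hUO, hUO', hOO'⟩ :=
    (normal_separation h.isClosed (h.isClosed_diff.union hY) hdisj)
  have hcov : ∀ p, F p ∈ Icc c s → p ∈ O ∪ O' := fun p hp => by
    by_cases hpU : p ∈ U
    · exact Or.inl (hUO hpU)
    · exact Or.inr (hUO' (Or.inl ⟨hp, hpU⟩))
  obtain ⟨t, hst, ht⟩ : ∃ t > s, ∀ p, F p ∈ Icc c t → p ∈ O ∪ O' := by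
    have hK : IsCompact ((O ∪ O')ᶜ ∩ F ⁻¹' Ici c) :=
      ((hO.union hO').isClosed_compl.inter (isClosed_Ici.preimage hF)).isCompact
    rcases ((O ∪ O')ᶜ ∩ F ⁻¹' Ici c).eq_empty_or_nonempty with he | hne
    · refine ⟨s + 1, by linarith, fun p hp => ?_⟩
      by_contra hn
      exact (he ▸ (⟨hn, hp.1⟩ : p ∈ (O ∪ O')ᶜ ∩ F ⁻¹' Ici c) : p ∈ (∅ : Set X))
    · obtain ⟨m, ⟨hm1, hm2⟩, hm⟩ := hK.exists_isMinOn hne hF.continuousOn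
      have hsm : s < F m := by
        by_contra hn
        exact hm1 (hcov m ⟨hm2, not_lt.1 hn⟩)
      refine ⟨(s + F m) / 2, by linarith, fun p hp => ?_⟩
      by_contra hn
      have := isMinOn_iff.1 hm p ⟨hn, hp.1⟩
      linarith [hp.2]
  have hband : IsClosed (F ⁻¹' Icc c t) := isClosed_Icc.preimage hF
  have hx : ∀ p, p ∈ O → p ∉ O' := fun p h1 h2 => disjoint_left.1 hOO' h1 h2
  refine ⟨t, hst, F ⁻¹' Icc c t ∩ O, inter_subset_left, ?_, ?_, ?_, ?_⟩
  · have : F ⁻¹' Icc c t ∩ O = F ⁻¹' Icc c t \ O' := by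
      ext p
      exact ⟨fun hp => ⟨hp.1, hx p hp.2⟩, fun hp => ⟨hp.1, (ht p hp.1).resolve_right hp.2⟩⟩
    rw [this]
    exact hband.sdiff hO'
  · rw [sdiff_self_inter]
    exact hband.sdiff hO
  · ext p
    constructor
    · rintro ⟨⟨_, hpO⟩, hpc⟩
      have hpc' : F p = c := hpc
      refine (h.mem_iff_of_level hpc').1 ?_
      by_contra hpU
      exact hx p hpO (hUO' (Or.inl ⟨⟨hpc'.ge, hpc'.le.trans hcs⟩, hpU⟩))
    · intro hp
      rw [← h.level] at hp
      have hpc' : F p = c := hp.2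
      exact ⟨⟨⟨hpc'.ge, by linarith⟩, hUO hp.1⟩, hp.2⟩
  · exact hOO'.mono inter_subset_right fun p hp => hUO' (Or.inr hp)

end IsBandSplitting

/-- The topological trace left just below the point `p` by a local product structure of `F` which is
compatible with `Y`: `p` is a limit of points of lower level, and of such points of `Y` if `p ∈ Y`,
and arbitrarily small neighbourhoods of `p` meet `{F < F p}` in a preconnected set. -/
structure IsRegularFromBelow {X : Type*} [TopologicalSpace X] (F : X → ℝ) (Y : Set X) (p : X) :
    Prop where
  mem_closure : p ∈ closure {q | F q < F p}
  exists_preconnected : ∀ O ∈ 𝓝 p, ∃ N ∈ 𝓝 p, N ⊆ O ∧ IsPreconnected (N ∩ {q | F q < F p})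
  mem_closure_inter : p ∈ Y → p ∈ closure (Y ∩ {q | F q < F p})

namespace IsBandSplitting

variable {X : Type*} [TopologicalSpace X] {F : X → ℝ} {Y V : Set X} {c s t : ℝ} {U U' : Set X}

/-- The limit step: by uniqueness the splittings of the lower bands fit together, and connectedness
of the part of a small neighbourhood below the new level keeps the closures of the two sides
disjoint. -/
theorem exists_of_forall_lt [CompactSpace X] (hF : Continuous F)
    (hreg : ∀ p, c < F p → IsRegularFromBelow F Y p) (hct : c < t)
    (h : ∀ s ∈ Ico c t, ∃ U, IsBandSplitting F Y V c s U) :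
    ∃ U, IsBandSplitting F Y V c t U := by
  choose! W hW using h
  -- `A` and `B` are the two sides of the half-open band; both are relatively open in `{c ≤ F}`.
  set A : Set X := ⋃ s ∈ Ico c t, W s with hA
  set B : Set X := F ⁻¹' Ico c t \ A with hB
  have hmemA : ∀ s ∈ Ico c t, ∀ p, F p ≤ s → (p ∈ A ↔ p ∈ W s) := by
    intro s hs p hps
    refine ⟨fun hp => ?_, fun hp => mem_biUnion hs hp⟩
    obtain ⟨s', hs', hp⟩ := mem_iUnion₂.1 hp
    have hcp : c ≤ F p := ((hW s' hs').subset hp).1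
    have key : ∀ {r}, r ∈ Ico c t → F p ≤ r →
        IsBandSplitting F Y V c (F p) (W r ∩ F ⁻¹' Iic (F p)) := fun hr hpr =>
      (hW _ hr).restrict hF hcp hpr
    exact (subset_of_forall_mem_closure hF (fun p hp => (hreg p hp).mem_closure)
      (key hs' ((hW s' hs').subset hp).2) (key hs hps) ⟨hp, le_refl (F p)⟩).1
  have hAsub : A ⊆ F ⁻¹' Ico c t := by
    intro p hp
    obtain ⟨s', hs', hp⟩ := mem_iUnion₂.1 hp
    exact ⟨((hW s' hs').subset hp).1, ((hW s' hs').subset hp).2.trans_lt hs'.2⟩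
  have hnA : ∀ p ∈ A, ∃ O ∈ 𝓝 p, O ∩ F ⁻¹' Ici c ⊆ A := by
    intro p hp
    obtain ⟨s, hps, hst⟩ := exists_between (hAsub hp).2
    have hs : s ∈ Ico c t := ⟨(hAsub hp).1.trans hps.le, hst⟩
    refine ⟨(F ⁻¹' Icc c s \ W s)ᶜ ∩ F ⁻¹' Iio s, ((hW s hs).isClosed_diff.isOpen_compl.inter
      (isOpen_Iio.preimage hF)).mem_nhds ⟨fun hn => hn.2 ((hmemA s hs p hps.le).1 hp), hps⟩, ?_⟩
    rintro q ⟨⟨hq1, hq2⟩, hq3⟩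
    have hq2' : F q < s := hq2
    refine (hmemA s hs q hq2'.le).2 ?_
    by_contra hq
    exact hq1 ⟨⟨hq3, hq2'.le⟩, hq⟩
  have hnB : ∀ p ∈ B, ∃ O ∈ 𝓝 p, O ∩ F ⁻¹' Ici c ⊆ B := by
    intro p hp
    obtain ⟨s, hps, hst⟩ := exists_between hp.1.2
    have hs : s ∈ Ico c t := ⟨hp.1.1.trans hps.le, hst⟩
    refine ⟨(W s)ᶜ ∩ F ⁻¹' Iio s, ((hW s hs).isClosed.isOpen_compl.inter
      (isOpen_Iio.preimage hF)).mem_nhds ⟨fun hn => hp.2 ((hmemA s hs p hps.le).2 hn), hps⟩, ?_⟩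
    rintro q ⟨⟨hq1, hq2⟩, hq3⟩
    have hq2' : F q < s := hq2
    exact ⟨⟨hq3, hq2'.trans hst⟩, fun hq => hq1 ((hmemA s hs q hq2'.le).1 hq)⟩
  have hopen : ∀ S : Set X, (∀ p ∈ S, ∃ O ∈ 𝓝 p, O ∩ F ⁻¹' Ici c ⊆ S) →
      IsOpen (S ∩ F ⁻¹' Ioi c) := by
    intro S hS
    rw [isOpen_iff_mem_nhds]
    rintro p ⟨hp, hpc⟩
    obtain ⟨O, hO, hOS⟩ := hS p hp
    filter_upwards [hO, (isOpen_Ioi.preimage hF).mem_nhds hpc] with q h1 h2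
    exact ⟨hOS ⟨h1, le_of_lt (show c < F q from h2)⟩, h2⟩
  have hclA : closure A ⊆ F ⁻¹' Icc c t :=
    closure_minimal (fun p hp => ⟨(hAsub hp).1, (hAsub hp).2.le⟩) (isClosed_Icc.preimage hF)
  have hclB : closure B ⊆ F ⁻¹' Icc c t :=
    closure_minimal (fun p hp => ⟨hp.1.1, hp.1.2.le⟩) (isClosed_Icc.preimage hF)
  have hdisj : ∀ p, p ∈ closure A → p ∉ closure B := by
    intro p hpA hpB
    rcases lt_or_eq_of_le (hclA hpA).2 with hlt | heq
    · by_cases hp : p ∈ A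
      · obtain ⟨O, hO, hOA⟩ := hnA p hp
        obtain ⟨q, hqO, hqB⟩ := mem_closure_iff_nhds.1 hpB O hO
        exact hqB.2 (hOA ⟨hqO, hqB.1.1⟩)
      · obtain ⟨O, hO, hOB⟩ := hnB p ⟨⟨(hclA hpA).1, hlt⟩, hp⟩
        obtain ⟨q, hqO, hqA⟩ := mem_closure_iff_nhds.1 hpA O hO
        exact (hOB ⟨hqO, (hAsub hqA).1⟩).2 hqA
    · have hcp : c < F p := hct.trans_eq heq.symm
      obtain ⟨N, hN, hNc, hconn⟩ := (hreg p hcp).exists_preconnected _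
        ((isOpen_Ioi.preimage hF).mem_nhds hcp)
      obtain ⟨a, haN, haA⟩ := mem_closure_iff_nhds.1 hpA N hN
      obtain ⟨b, hbN, hbB⟩ := mem_closure_iff_nhds.1 hpB N hN
      obtain ⟨q, -, ⟨hqA, -⟩, ⟨hqB, -⟩⟩ := hconn _ _ (hopen A hnA) (hopen B hnB)
        (fun q ⟨hqN, hq⟩ => by
          have hq' : F q < t := heq ▸ hq
          have hqc : c < F q := hNc hqN
          by_cases hqA : q ∈ A
          · exact Or.inl ⟨hqA, hqc⟩
          · exact Or.inr ⟨⟨⟨hqc.le, hq'⟩, hqA⟩, hqc⟩)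
        ⟨a, ⟨haN, show F a < F p from heq ▸ (hAsub haA).2⟩, haA, hNc haN⟩
        ⟨b, ⟨hbN, show F b < F p from heq ▸ hbB.1.2⟩, hbB, hNc hbN⟩
      exact hqB.2 hqA
  have hcov : ∀ p, F p ∈ Icc c t → p ∉ closure A → p ∈ closure B := by
    intro p hp hpA
    rcases lt_or_eq_of_le hp.2 with hlt | heq
    · exact subset_closure ⟨⟨hp.1, hlt⟩, fun h => hpA (subset_closure h)⟩
    · have hcp : c < F p := hct.trans_eq heq.symm
      have hp' : p ∈ closure (A ∪ B) := by
        rw [mem_closure_iff_nhds]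
        intro O hO
        obtain ⟨q, ⟨hqO, hqc⟩, hq⟩ := mem_closure_iff_nhds.1 (hreg p hcp).mem_closure
          _ (inter_mem hO ((isOpen_Ioi.preimage hF).mem_nhds hcp))
        have hq' : F q < t := heq ▸ hq
        refine ⟨q, hqO, ?_⟩
        by_cases hqA : q ∈ A
        · exact Or.inl hqA
        · exact Or.inr ⟨⟨le_of_lt hqc, hq'⟩, hqA⟩
      rw [closure_union] at hp'
      exact hp'.resolve_left hpA
  have hAlt : ∀ p ∈ closure A, F p < t → p ∈ A := by
    intro p hp hlt
    by_contra hpA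
    exact hdisj p hp (subset_closure ⟨⟨(hclA hp).1, hlt⟩, hpA⟩)
  have hc : c ∈ Ico c t := ⟨le_rfl, hct⟩
  refine ⟨closure A, hclA, isClosed_closure, ?_, ?_, ?_⟩
  · have : F ⁻¹' Icc c t \ closure A = closure B := by
      ext p
      exact ⟨fun hp => hcov p hp.1 hp.2, fun hp => ⟨hclB hp, fun hpA => hdisj p hpA hp⟩⟩
    rw [this]
    exact isClosed_closure
  · ext p
    constructor
    · rintro ⟨hp, hpc⟩
      have hpc' : F p = c := hpc
      have hpA := hAlt p hp (hpc'.trans_lt hct)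
      exact ((hW c hc).mem_iff_of_level hpc').1 ((hmemA c hc p hpc'.le).1 hpA)
    · intro hp
      have hp' := hp
      rw [← (hW c hc).level] at hp'
      exact ⟨subset_closure (mem_biUnion hc hp'.1), hp'.2⟩
  · refine disjoint_left.2 fun p hp hpY => ?_
    rcases lt_or_eq_of_le (hclA hp).2 with hlt | heq
    · obtain ⟨s, hs, hps⟩ := mem_iUnion₂.1 (hAlt p hp hlt)
      exact disjoint_left.1 (hW s hs).disjoint hps hpY
    · have hcp : c < F p := hct.trans_eq heq.symm
      refine hdisj p hp ?_
      rw [mem_closure_iff_nhds]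
      intro O hO
      obtain ⟨q, ⟨hqO, hqc⟩, hqY, hq⟩ := mem_closure_iff_nhds.1
        ((hreg p hcp).mem_closure_inter hpY) _
        (inter_mem hO ((isOpen_Ioi.preimage hF).mem_nhds hcp))
      have hq' : F q < t := heq ▸ hq
      refine ⟨q, hqO, ⟨le_of_lt hqc, hq'⟩, fun hqA => ?_⟩
      obtain ⟨s, hs, hqs⟩ := mem_iUnion₂.1 hqA
      exact disjoint_left.1 (hW s hs).disjoint hqs hqY

/-- A clopen subset of the level `{F = c}` disjoint from `Y` extends to every band above it, by real
induction on the height of the band. -/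
theorem exists_of_isRegularFromBelow [CompactSpace X] [T2Space X] (hF : Continuous F)
    (hY : IsClosed Y) (hVc : V ⊆ F ⁻¹' {c}) (hV : IsClosed V) (hV' : IsClosed (F ⁻¹' {c} \ V))
    (hVY : Disjoint V Y) (hreg : ∀ p, c < F p → IsRegularFromBelow F Y p) (hct : c ≤ t) :
    ∃ U, IsBandSplitting F Y V c t U := by
  have hclosed : IsClosed ({s | ∃ U, IsBandSplitting F Y V c s U} ∩ Icc c t) := by
    rw [← closure_subset_iff_isClosed]
    intro x hx
    have hxI : x ∈ Icc c t := closure_minimal inter_subset_right isClosed_Icc hx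
    refine ⟨?_, hxI⟩
    by_cases hge : ∃ s, x ≤ s ∧ ∃ U, IsBandSplitting F Y V c s U
    · obtain ⟨s, hs, U, hU⟩ := hge
      exact ⟨_, hU.restrict hF hxI.1 hs⟩
    · have hlt : ∀ s ∈ Ico c x, ∃ U, IsBandSplitting F Y V c s U := by
        intro s hs
        obtain ⟨r, hr, ⟨U, hU⟩, -⟩ := mem_closure_iff_nhds.1 hx _ (Ioi_mem_nhds hs.2)
        exact ⟨_, hU.restrict hF hs.1 (le_of_lt hr)⟩
      rcases hxI.1.lt_or_eq with hcx | rfl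
      · exact exists_of_forall_lt hF hreg hcx hlt
      · obtain ⟨r, -, ⟨U, hU⟩, hr⟩ := mem_closure_iff_nhds.1 hx _ univ_mem
        exact ⟨_, hU.restrict hF le_rfl hr.1⟩
  refine hclosed.mem_of_ge_of_forall_exists_gt ⟨V, ?_⟩ hct ?_
  · refine ⟨?_, hV, ?_, inter_eq_left.2 hVc, hVY⟩ <;> simpa using by assumption
  · rintro s ⟨⟨U, hU⟩, hs⟩
    obtain ⟨r, hr, U', hU'⟩ := hU.exists_gt hF hY hs.1
    exact ⟨min r t, ⟨_, hU'.restrict hF (hs.1.trans (le_min hr.le hs.2.le)) (min_le_left _ _)⟩,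
      lt_min hr hs.2, min_le_right _ _⟩

end IsBandSplitting

/-- If `F` is regular from below at all points above the level of `z`, and `-F` at all points below
it, then `Y` meets the component of `z` in its level as soon as it meets the component of `z` in the
whole space. -/
theorem connectedComponentIn_inter_nonempty_of_isRegular {X : Type*} [TopologicalSpace X]
    [CompactSpace X] [T2Space X] {F : X → ℝ} (hF : Continuous F) {Y : Set X} (hY : IsClosed Y)
    {z : X} (hbelow : ∀ p, F z < F p → IsRegularFromBelow F Y p)
    (habove : ∀ p, F p < F z → IsRegularFromBelow (-F) Y p)
    (hz : (connectedComponent z ∩ Y).Nonempty) :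
    (connectedComponentIn (F ⁻¹' {F z}) z ∩ Y).Nonempty := by
  by_contra hempty
  rw [not_nonempty_iff_eq_empty] at hempty
  set L := F ⁻¹' {F z} with hL
  have hLc : IsClosed L := isClosed_singleton.preimage hF
  have hzL : z ∈ L := rfl
  -- The component of `z` in the compact space `L` is an intersection of clopen sets.
  obtain ⟨V, hVL, hV, hV', hzV, hVY⟩ : ∃ V ⊆ L, IsClosed V ∧ IsClosed (L \ V) ∧ z ∈ V ∧
      Disjoint V Y := by
    have : CompactSpace L := isCompact_iff_compactSpace.1 hLc.isCompact
    have hYL : IsCompact ((↑) ⁻¹' Y : Set L) := (hY.preimage continuous_subtype_val).isCompact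
    rw [connectedComponentIn_eq_image hzL, connectedComponent_eq_iInter_isClopen] at hempty
    obtain ⟨u, hu⟩ := hYL.elim_finite_subfamily_closed
      (fun s : { s : Set L // IsClopen s ∧ (⟨z, hzL⟩ : L) ∈ s } => s.1) (fun s => s.2.1.isClosed)
      (by
        rw [eq_empty_iff_forall_notMem] at hempty ⊢
        exact fun x hx => hempty x ⟨⟨x, hx.2, rfl⟩, hx.1⟩)
    have hclopen : IsClopen (⋂ s ∈ u, s.1) := isClopen_biInter_finset fun s _ => s.2.1
    refine ⟨(↑) '' (⋂ s ∈ u, s.1), by simp, hLc.isClosedEmbedding_subtypeVal.isClosedMap _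
      hclopen.isClosed, ?_, ⟨⟨z, hzL⟩, mem_iInter₂.2 fun s _ => s.2.2, rfl⟩, ?_⟩
    · have : L \ (↑) '' (⋂ s ∈ u, s.1) = ((↑) '' (⋂ s ∈ u, s.1)ᶜ : Set X) := by
        rw [image_compl_eq_range_sdiff_image Subtype.val_injective, Subtype.range_coe]
      rw [this]
      exact hLc.isClosedEmbedding_subtypeVal.isClosedMap _ hclopen.compl.isClosed
    · rw [disjoint_left]
      rintro _ ⟨x, hx, rfl⟩ hxY
      exact (hu ▸ ⟨hxY, hx⟩ : x ∈ (∅ : Set L))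
  obtain ⟨M, hM⟩ := isCompact_univ.bddAbove_image (f := fun p => |F p|) hF.abs.continuousOn
  have hM' : ∀ p, |F p| ≤ M := fun p => hM ⟨p, mem_univ _, rfl⟩
  obtain ⟨U₁, hU₁⟩ := IsBandSplitting.exists_of_isRegularFromBelow (t := M) hF hY hVL hV hV' hVY
    hbelow ((le_abs_self _).trans (hM' z))
  have hLneg : (-F) ⁻¹' {-F z} = L := by
    ext p; simp [hL]
  obtain ⟨U₂, hU₂⟩ := IsBandSplitting.exists_of_isRegularFromBelow (t := M) (c := -F z) hF.neg hY
    (hVL.trans hLneg.ge) hV (by rwa [hLneg]) hVY (fun p hp => habove p (neg_lt_neg_iff.1 hp))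
    ((neg_le_abs _).trans (hM' z))
  have hb₁ : F ⁻¹' Icc (F z) M = F ⁻¹' Ici (F z) := by
    ext p; simp [(le_abs_self _).trans (hM' p)]
  have hb₂ : (-F) ⁻¹' Icc (-F z) M = F ⁻¹' Iic (F z) := by
    ext p; simp [(neg_le_abs _).trans (hM' p)]
  -- The two pieces agree on the level of `z`, hence their union has a closed complement.
  have hclopen : IsClopen (U₁ ∪ U₂) := by
    refine ⟨hU₁.isClosed.union hU₂.isClosed, ?_⟩
    have : (U₁ ∪ U₂)ᶜ = (F ⁻¹' Ici (F z) \ U₁) ∪ (F ⁻¹' Iic (F z) \ U₂) := by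
      ext p
      simp only [mem_compl_iff, mem_union, Set.mem_sdiff, mem_preimage, mem_Ici, mem_Iic, not_or]
      constructor
      · rintro ⟨h1, h2⟩
        rcases le_total (F z) (F p) with h | h
        · exact Or.inl ⟨h, h1⟩
        · exact Or.inr ⟨h, h2⟩
      · have hlev : F p = F z → (p ∈ U₁ ↔ p ∈ U₂) := fun h =>
          (hU₁.mem_iff_of_level h).trans (hU₂.mem_iff_of_level (by simp [h])).symm
        rintro (⟨h, hp⟩ | ⟨h, hp⟩)
        · refine ⟨hp, fun hp2 => hp ((hlev (le_antisymm ?_ h)).2 hp2)⟩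
          exact (hb₂ ▸ hU₂.subset hp2 : p ∈ F ⁻¹' Iic (F z))
        · refine ⟨fun hp1 => hp ((hlev (le_antisymm h ?_)).1 hp1), hp⟩
          exact (hU₁.subset hp1).1
    rw [← isClosed_compl_iff, this]
    exact (hb₁ ▸ hU₁.isClosed_diff).union (hb₂ ▸ hU₂.isClosed_diff)
  obtain ⟨y, hyC, hyY⟩ := hz
  have hzU : z ∈ U₁ ∪ U₂ := Or.inl ((hU₁.mem_iff_of_level rfl).2 hzV)
  rcases hclopen.connectedComponent_subset hzU hyC with h | h
  · exact disjoint_left.1 hU₁.disjoint h hyY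
  · exact disjoint_left.1 hU₂.disjoint h hyY

/-! ### Sliding along a direction of decrease -/

section Slide

variable {E : Type*} [NormedAddCommGroup E] [NormedSpace ℝ E]

theorem Convex.add_smul_mem_of_le {Q : Set E} (hQ : Convex ℝ Q) {y w : E} {s τ : ℝ}
    (hy : y ∈ Q) (hyw : y + τ • w ∈ Q) (hs : 0 ≤ s) (hsτ : s ≤ τ) : y + s • w ∈ Q := by
  rcases hs.eq_or_lt with rfl | hs
  · simpa using hy
  · have hτ : 0 < τ := hs.trans_le hsτ
    have := hQ.add_smul_mem hy hyw (t := s / τ) ⟨by positivity, (div_le_one hτ).2 hsτ⟩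
    rwa [smul_smul, div_mul_cancel₀ _ hτ.ne'] at this

/-- If `f` has negative derivative at `x` in a direction `w` along which `Q` is not left, then `x`
has small neighbourhoods in `Q` meeting `{f < f x}` in a preconnected set. Near `x` the function
decreases along the lines in direction `w`, so every point of the sublevel
set can be slid along `w` into a convex cross-section. -/
theorem exists_isPreconnected_sublevel {Q : Set E} (hQ : Convex ℝ Q) {f : E → ℝ}
    {f' : E → E →L[ℝ] ℝ} {x w : E} (hx : x ∈ Q)
    (hf : ∀ᶠ y in 𝓝[Q] x, HasFDerivWithinAt f (f' y) Q y)
    (hf' : ContinuousWithinAt f' Q x) (hw : f' x w < 0) {τ₀ : ℝ} (hτ₀ : 0 < τ₀)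
    (hadm : ∀ᶠ y in 𝓝[Q] x, y + τ₀ • w ∈ Q) :
    (∀ O ∈ 𝓝[Q] x, ∃ N ∈ 𝓝[Q] x, N ⊆ O ∧ IsPreconnected (N ∩ {y | f y < f x})) ∧
      ∀ᶠ t in 𝓝[>] (0 : ℝ), x + t • w ∈ Q ∧ f (x + t • w) < f x := by
  have hneg : ∀ᶠ y in 𝓝[Q] x, f' y w < 0 :=
    (hf'.clm_apply continuousWithinAt_const).eventually_lt continuousWithinAt_const hw
  -- Short segments in direction `w` from points of `Q` near `x` stay in `Q ∩ O`, and `f` decreases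
  -- along them.
  have main : ∀ O ∈ 𝓝[Q] x, ∃ r > 0, ∃ τ > 0, (∀ y ∈ Q, dist y x < r → ∀ s ∈ Icc 0 τ,
      y + s • w ∈ Q ∧ y + s • w ∈ O ∧ ContinuousWithinAt f Q (y + s • w)) ∧
      ∀ y ∈ Q, dist y x < r → StrictAntiOn (fun s : ℝ => f (y + s • w)) (Icc 0 τ) := by
    intro O hO
    obtain ⟨r, hr, hball⟩ := Metric.mem_nhdsWithin_iff.1
      (hf.and (hneg.and (hadm.and hO)))
    have hball' : ∀ y ∈ Q, dist y x < r → HasFDerivWithinAt f (f' y) Q y ∧ f' y w < 0 ∧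
        y + τ₀ • w ∈ Q ∧ y ∈ O := fun y hy hyr => hball ⟨hyr, hy⟩
    set τ := min τ₀ (r / 2 / (‖w‖ + 1)) with hτ
    have hτpos : 0 < τ := lt_min hτ₀ (by positivity)
    have hτw : τ * ‖w‖ ≤ r / 2 := by
      have h1 : τ * (‖w‖ + 1) ≤ r / 2 := by
        rw [← le_div_iff₀ (by positivity)]
        exact min_le_right _ _
      nlinarith
    have hmem : ∀ y ∈ Q, dist y x < r / 2 → ∀ s ∈ Icc 0 τ, y + s • w ∈ Q ∧
        dist (y + s • w) x < r := by
      intro y hy hyr s hs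
      refine ⟨hQ.add_smul_mem_of_le hy (hball' y hy (by linarith)).2.2.1 hs.1
        (hs.2.trans (min_le_left _ _)), ?_⟩
      calc dist (y + s • w) x ≤ dist (y + s • w) y + dist y x := dist_triangle _ _ _
        _ = s * ‖w‖ + dist y x := by
          rw [dist_eq_norm, add_sub_cancel_left, norm_smul, Real.norm_of_nonneg hs.1]
        _ < r := by nlinarith [hs.2, norm_nonneg w]
    refine ⟨r / 2, by positivity, τ, hτpos, fun y hy hyr s hs => ?_, fun y hy hyr => ?_⟩
    · obtain ⟨h1, h2⟩ := hmem y hy hyr s hs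
      have h3 := hball' _ h1 h2
      exact ⟨h1, h3.2.2.2, h3.1.continuousWithinAt⟩
    · have hd : ∀ s ∈ Icc 0 τ, HasDerivWithinAt (fun s : ℝ => f (y + s • w))
          (f' (y + s • w) w) (Icc 0 τ) s := by
        intro s hs
        obtain ⟨h1, h2⟩ := hmem y hy hyr s hs
        have hline : HasDerivWithinAt (fun s : ℝ => y + s • w) w (Icc 0 τ) s := by
          simpa using ((hasDerivWithinAt_id s (Icc 0 τ)).smul_const w).const_add y
        exact (hball' _ h1 h2).1.comp_hasDerivWithinAt s hline
          fun t ht => (hmem y hy hyr t ht).1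
      refine strictAntiOn_of_hasDerivWithinAt_neg (convex_Icc 0 τ)
        (fun s hs => (hd s hs).continuousWithinAt)
        (fun s hs => (hd s (interior_subset hs)).mono interior_subset) fun s hs => ?_
      obtain ⟨h1, h2⟩ := hmem y hy hyr s (interior_subset hs)
      exact (hball' _ h1 h2).2.1
  constructor
  · intro O hO
    obtain ⟨r, hr, τ, hτ, hmem, hanti⟩ := main O hO
    have hxτ : f (x + τ • w) < f x := by
      simpa using hanti x hx (by simpa using hr) (left_mem_Icc.2 hτ.le) (right_mem_Icc.2 hτ.le) hτ
    -- The far end of the cylinder over a small ball lies below the level of `x`.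
    have hend : ∀ᶠ y in 𝓝[Q] x, f (y + τ • w) < f x := by
      have hcont : ContinuousWithinAt f Q (x + τ • w) :=
        (hmem x hx (by simpa using hr) τ (right_mem_Icc.2 hτ.le)).2.2
      have htend : Tendsto (fun y => y + τ • w) (𝓝[Q] x) (𝓝[Q] (x + τ • w)) := by
        refine tendsto_nhdsWithin_iff.2
          ⟨((continuous_id.add continuous_const).tendsto x).mono_left nhdsWithin_le_nhds, ?_⟩
        filter_upwards [self_mem_nhdsWithin, mem_nhdsWithin_of_mem_nhds (Metric.ball_mem_nhds x hr)]
          with y hy hyr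
        exact (hmem y hy hyr τ (right_mem_Icc.2 hτ.le)).1
      exact (hcont.tendsto.comp htend).eventually_lt_const hxτ
    obtain ⟨δ, hδ, hball⟩ := Metric.mem_nhdsWithin_iff.1 hend
    set ε := min r δ with hε
    have hεpos : 0 < ε := lt_min hr hδ
    set C : Set E := Metric.ball x ε ∩ Q with hC
    have hCr : ∀ y ∈ C, dist y x < r := fun y hy => lt_of_lt_of_le hy.1 (min_le_left _ _)
    have hCδ : ∀ y ∈ C, f (y + τ • w) < f x := fun y hy =>
      hball ⟨Metric.ball_subset_ball (min_le_right _ _) hy.1, hy.2⟩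
    have hCc : Convex ℝ C := (convex_ball x ε).inter hQ
    have hxC : x ∈ C := ⟨Metric.mem_ball_self hεpos, hx⟩
    -- The neighbourhood is the union of the segments from `y` to `y + τ • w` with `y ∈ C`.
    refine ⟨{q | ∃ y ∈ C, ∃ s ∈ Icc 0 τ, y + s • w = q}, ?_, ?_, ?_⟩
    · refine mem_of_superset (inter_mem (mem_nhdsWithin_of_mem_nhds
        (Metric.ball_mem_nhds x hεpos)) self_mem_nhdsWithin) fun y hy => ?_
      exact ⟨y, hy, 0, left_mem_Icc.2 hτ.le, by simp⟩
    · rintro _ ⟨y, hy, s, hs, rfl⟩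
      exact (hmem y hy.2 (hCr y hy) s hs).2.1
    · refine isPreconnected_of_forall (x + τ • w) ?_
      rintro _ ⟨⟨y, hy, s, hs, rfl⟩, hlt⟩
      refine ⟨(fun s' : ℝ => y + s' • w) '' Icc s τ ∪ (fun y' => y' + τ • w) '' C, ?_,
        Or.inr ⟨x, hxC, rfl⟩, Or.inl ⟨s, left_mem_Icc.2 hs.2, rfl⟩, ?_⟩
      · rintro _ (⟨s', hs', rfl⟩ | ⟨y', hy', rfl⟩)
        · have hs'' : s' ∈ Icc 0 τ := ⟨hs.1.trans hs'.1, hs'.2⟩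
          exact ⟨⟨y, hy, s', hs'', rfl⟩,
            ((hanti y hy.2 (hCr y hy)).antitoneOn hs hs'' hs'.1).trans_lt hlt⟩
        · exact ⟨⟨y', hy', τ, right_mem_Icc.2 hτ.le, rfl⟩, hCδ y' hy'⟩
      · refine IsPreconnected.union (y + τ • w) ⟨τ, right_mem_Icc.2 hs.2, rfl⟩ ⟨y, hy, rfl⟩ ?_ ?_
        · exact isPreconnected_Icc.image _ (by fun_prop)
        · exact hCc.isPreconnected.image _ (by fun_prop)
  · obtain ⟨r, hr, τ, hτ, hmem, hanti⟩ := main univ univ_mem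
    filter_upwards [Ioo_mem_nhdsGT hτ] with t ht
    have ht' : t ∈ Icc 0 τ := ⟨ht.1.le, ht.2.le⟩
    refine ⟨(hmem x hx (by simpa using hr) t ht').1, ?_⟩
    simpa using hanti x hx (by simpa using hr) (left_mem_Icc.2 hτ.le) ht' ht.1

/-- One-sided derivative along a ray contained in the domain. -/
theorem HasFDerivWithinAt.hasDerivWithinAt_ray {Q : Set E} {f : E → ℝ} {f' : E →L[ℝ] ℝ} {x w : E}
    (hf : HasFDerivWithinAt f f' Q x) (hray : ∀ t : ℝ, 0 ≤ t → x + t • w ∈ Q) :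
    HasDerivWithinAt (fun t : ℝ => f (x + t • w)) (f' w) (Ici 0) 0 := by
  have hline : HasDerivWithinAt (fun s : ℝ => x + s • w) w (Ici 0) 0 := by
    simpa using ((hasDerivWithinAt_id (0 : ℝ) (Ici 0)).smul_const w).const_add x
  have hf0 : HasFDerivWithinAt f f' Q (x + (0 : ℝ) • w) := by simpa using hf
  exact hf0.comp_hasDerivWithinAt 0 hline fun t ht => hray t ht

end Slide

/-! ### Functions read in a chart -/

section Chart

variable {E H M : Type*} [NormedAddCommGroup E] [NormedSpace ℝ E] [TopologicalSpace H]
  [TopologicalSpace M] [ChartedSpace H M] {I : ModelWithCorners ℝ E H}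
  {φ : OpenPartialHomeomorph M H} {F : M → ℝ} {p : M}

theorem contDiffWithinAt_comp_extend_symm (hφ : φ ∈ IsManifold.maximalAtlas I ∞ M)
    (hF : ContMDiff I 𝓘(ℝ, ℝ) ∞ F) {y : E} (hy : y ∈ (φ.extend I).target) :
    ContDiffWithinAt ℝ ∞ (F ∘ (φ.extend I).symm) (range I) y := by
  have h1 : ContDiffOn ℝ ∞ (F ∘ (φ.extend I).symm) (I '' φ.target) :=
    (hF.comp_contMDiffOn (contMDiffOn_extend_symm hφ)).contDiffOn
  rw [← φ.extend_target'] at h1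
  refine (h1 y hy).mono_of_mem_nhdsWithin ?_
  obtain ⟨q, hq, rfl⟩ : ∃ q ∈ φ.source, φ.extend I q = y :=
    ⟨(φ.extend I).symm y, by simpa using (φ.extend I).map_target hy, (φ.extend I).right_inv hy⟩
  exact φ.extend_target_mem_nhdsWithin hq

/-- The chain rule for `F = (F ∘ φ⁻¹) ∘ φ`. -/
theorem mfderiv_eq_fderivWithin_extend (hφ : φ ∈ IsManifold.maximalAtlas I ∞ M)
    (hF : ContMDiff I 𝓘(ℝ, ℝ) ∞ F) (hp : p ∈ φ.source) (v : TangentSpace I p) :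
    (mfderiv I 𝓘(ℝ, ℝ) F p v : ℝ) = fderivWithin ℝ (F ∘ (φ.extend I).symm) (range I)
      (φ.extend I p) (mfderiv I 𝓘(ℝ, E) (φ.extend I) p v : E) := by
  have hx : φ.extend I p ∈ (φ.extend I).target :=
    (φ.extend I).map_source (by simpa using hp)
  have h1 : HasMFDerivAt I 𝓘(ℝ, E) (φ.extend I) p (mfderiv I 𝓘(ℝ, E) (φ.extend I) p) :=
    ((φ.contMDiffAt_extend hφ hp).mdifferentiableAt (by simp)).hasMFDerivAt
  have h2 := ((contDiffWithinAt_comp_extend_symm hφ hF hx).differentiableWithinAt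
    (by simp)).hasFDerivWithinAt.hasMFDerivWithinAt
  have h3 := HasMFDerivWithinAt.comp p h2 h1.hasMFDerivWithinAt (s := univ)
    (fun q _ => by simp)
  have h4 := (hasMFDerivWithinAt_univ.1 h3).congr_of_eventuallyEq (f₁ := F) (by
    filter_upwards [φ.extend_source_mem_nhds (I := I) hp] with q hq
    simp only [Function.comp_apply]
    rw [(φ.extend I).left_inv hq])
  rw [h4.mfderiv]
  rfl

/-- If, read in a chart, `F` has negative derivative in a direction which leaves neither the model
domain nor `Y`, then `F` is regular from below. -/
theorem IsRegularFromBelow.of_chart {Y : Set M} (hφ : φ ∈ IsManifold.maximalAtlas I ∞ M)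
    (hF : ContMDiff I 𝓘(ℝ, ℝ) ∞ F) (hp : p ∈ φ.source) {w : E}
    (hw : fderivWithin ℝ (F ∘ (φ.extend I).symm) (range I) (φ.extend I p) w < 0) {τ₀ : ℝ}
    (hτ₀ : 0 < τ₀) (hadm : ∀ᶠ y in 𝓝[range I] (φ.extend I p), y + τ₀ • w ∈ range I)
    (hY : p ∈ Y → ∀ t : ℝ, φ.extend I p + t • w ∈ (φ.extend I).target →
      (φ.extend I).symm (φ.extend I p + t • w) ∈ Y) :
    IsRegularFromBelow F Y p := by
  set f := F ∘ (φ.extend I).symm with hf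
  set x := φ.extend I p with hx
  have hxt : x ∈ (φ.extend I).target := (φ.extend I).map_source (by simpa using hp)
  have hxQ : x ∈ range I := φ.extend_target_subset_range hxt
  have hfx : f x = F p := by rw [hf, Function.comp_apply, hx, φ.extend_left_inv hp]
  have htar : (φ.extend I).target ∈ 𝓝[range I] x := φ.extend_target_mem_nhdsWithin hp
  have hmap : map (φ.extend I).symm (𝓝[range I] x) = 𝓝 p := φ.map_extend_symm_nhdsWithin_range hp
  have hsm := contDiffWithinAt_comp_extend_symm hφ hF hxt
  obtain ⟨hconn, hray⟩ := exists_isPreconnected_sublevel I.convex_range hxQ (f := f)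
    (f' := fderivWithin ℝ f (range I))
    (by
      filter_upwards [htar] with y hy
      exact ((contDiffWithinAt_comp_extend_symm hφ hF hy).differentiableWithinAt
        (by simp)).hasFDerivWithinAt)
    (hsm.fderivWithin_right (m := 0) I.uniqueDiffOn (by simp) hxQ).continuousWithinAt
    hw hτ₀ hadm
  have hlim : Tendsto (fun t : ℝ => x + t • w) (𝓝[>] 0) (𝓝[range I] x) := by
    refine tendsto_nhdsWithin_iff.2 ⟨?_, hray.mono fun t ht => ht.1⟩
    have : Continuous fun t : ℝ => x + t • w := by fun_prop
    simpa using (this.tendsto 0).mono_left nhdsWithin_le_nhds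
  have hlim' : Tendsto (fun t : ℝ => (φ.extend I).symm (x + t • w)) (𝓝[>] 0) (𝓝 p) :=
    hmap ▸ tendsto_map.comp hlim
  refine ⟨mem_closure_of_tendsto hlim' ?_, fun O hO => ?_, fun hpY =>
    mem_closure_of_tendsto hlim' ?_⟩
  · filter_upwards [hray] with t ht
    exact hfx ▸ ht.2
  · have hO' : (φ.extend I).symm ⁻¹' O ∩ (φ.extend I).target ∈ 𝓝[range I] x := by
      refine inter_mem ?_ htar
      rw [← hmap] at hO
      exact hO
    obtain ⟨N, hN, hNO, hNc⟩ := hconn _ hO'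
    refine ⟨(φ.extend I).symm '' N, hmap ▸ image_mem_map hN, ?_, ?_⟩
    · rintro _ ⟨y, hy, rfl⟩
      exact (hNO hy).1
    · have : (φ.extend I).symm '' N ∩ {q | F q < F p} =
          (φ.extend I).symm '' (N ∩ {y | f y < f x}) := by
        rw [hfx]
        exact (image_inter_preimage _ _ _).symm
      rw [this]
      exact hNc.image _ (φ.continuousOn_extend_symm.mono fun y hy => (hNO hy.1).2)
  · filter_upwards [hray, hlim htar] with t ht htt
    exact ⟨hY hpY t htt, hfx ▸ ht.2⟩

end Chart

/-! ### Regularity on a cobordism -/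

/-- A direction which does not decrease the vanishing coordinates of `x` keeps all points near `x`
in the quadrant for a uniform time. -/
theorem EuclideanQuadrant.exists_eventually_add_smul_mem {m : ℕ} {x w : EuclideanSpace ℝ (Fin m)}
    (h : ∀ j, 0 < x j ∨ 0 ≤ w j) :
    ∃ τ : ℝ, 0 < τ ∧ ∀ᶠ y in 𝓝[{y | ∀ j, 0 ≤ y j}] x,
      y + τ • w ∈ {y : EuclideanSpace ℝ (Fin m) | ∀ j, 0 ≤ y j} := by
  have h1 : ∀ᶠ τ : ℝ in 𝓝[>] 0, ∀ j, 0 ≤ w j ∨ 0 < x j + τ * w j := by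
    refine eventually_all.2 fun j => ?_
    rcases h j with h | h
    · have : Continuous fun τ : ℝ => x j + τ * w j := by fun_prop
      have h0 : ∀ᶠ τ in 𝓝 (0 : ℝ), 0 < x j + τ * w j :=
        this.continuousAt.eventually (lt_mem_nhds (by simpa using h))
      exact (h0.filter_mono nhdsWithin_le_nhds).mono fun τ hτ => Or.inr hτ
    · exact Eventually.of_forall fun _ => Or.inl h
  obtain ⟨τ, hτ, hτ0⟩ := (h1.and self_mem_nhdsWithin).exists
  have hτ0 : 0 < τ := hτ0
  refine ⟨τ, hτ0, ?_⟩
  have h2 : ∀ᶠ y in 𝓝[{y | ∀ j, 0 ≤ y j}] x, ∀ j, 0 ≤ w j ∨ 0 < y j + τ * w j := by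
    refine eventually_all.2 fun j => ?_
    rcases hτ j with h | h
    · exact Eventually.of_forall fun _ => Or.inl h
    · have : Continuous fun y : EuclideanSpace ℝ (Fin m) => y j + τ * w j := by fun_prop
      have h0 : ∀ᶠ y in 𝓝 x, 0 < y j + τ * w j := this.continuousAt.eventually (lt_mem_nhds h)
      exact (h0.filter_mono nhdsWithin_le_nhds).mono fun τ hτ => Or.inr hτ
  filter_upwards [h2, self_mem_nhdsWithin] with y hy hyQ j
  have := hyQ j
  rcases hy j with h | h
  · simp only [PiLp.add_apply, PiLp.smul_apply, smul_eq_mul]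
    positivity
  · simpa using h.le

theorem range_cornerModel (n : ℕ) :
    range (cornerModel n) = {y : EuclideanSpace ℝ (Fin (n + 1)) | ∀ j, 0 ≤ y j} :=
  range_euclideanQuadrant (n + 1)

/-- Let `f` attain a maximum at a point `x` of the face `y k = 0` of the quadrant and be constant on
that face near `x`. If `x` is not critical, then `f` decreases in the inward normal direction. -/
theorem EuclideanQuadrant.fderiv_single_neg {m : ℕ} {f : EuclideanSpace ℝ (Fin m) → ℝ}
    {f' : EuclideanSpace ℝ (Fin m) →L[ℝ] ℝ} {x : EuclideanSpace ℝ (Fin m)} {k : Fin m}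
    (hx : ∀ j, 0 ≤ x j) (hxk : x k = 0)
    (hf : HasFDerivWithinAt f f' {y | ∀ j, 0 ≤ y j} x) (hf' : f' ≠ 0) (hmax : ∀ y, f y ≤ f x)
    (hconst : ∀ᶠ y in 𝓝[{y | ∀ j, 0 ≤ y j}] x, y k = 0 → f y = f x) :
    f' (EuclideanSpace.single k 1) < 0 := by
  have hray : ∀ j, ∀ t : ℝ, 0 ≤ t → x + t • EuclideanSpace.single j (1 : ℝ) ∈
      {y : EuclideanSpace ℝ (Fin m) | ∀ j, 0 ≤ y j} := by
    intro j t ht i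
    have := hx i
    by_cases hij : i = j
    · subst hij
      simpa using by positivity
    · simpa [hij] using this
  have hzero : ∀ j, j ≠ k → f' (EuclideanSpace.single j 1) = 0 := by
    intro j hj
    have hlim : Tendsto (fun t : ℝ => x + t • EuclideanSpace.single j (1 : ℝ)) (𝓝[≥] 0)
        (𝓝[{y | ∀ j, 0 ≤ y j}] x) := by
      refine tendsto_nhdsWithin_iff.2 ⟨?_, ?_⟩
      · have : Continuous fun t : ℝ => x + t • EuclideanSpace.single j (1 : ℝ) := by fun_prop
        simpa using (this.tendsto 0).mono_left nhdsWithin_le_nhds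
      · filter_upwards [self_mem_nhdsWithin] with t ht
        exact hray j t ht
    have hev : ∀ᶠ t in 𝓝[≥] (0 : ℝ), f (x + t • EuclideanSpace.single j (1 : ℝ)) = f x := by
      filter_upwards [hlim.eventually hconst] with t ht
      exact ht (by simp [hj.symm, hxk])
    have hd0 : HasDerivWithinAt (fun t : ℝ => f (x + t • EuclideanSpace.single j (1 : ℝ))) 0
        (Ici 0) 0 :=
      (hasDerivWithinAt_const (0 : ℝ) (Ici 0) (f x)).congr_of_eventuallyEq hev (by simp)
    exact (uniqueDiffOn_Ici (0 : ℝ) 0 self_mem_Ici).eq_deriv _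
      (hf.hasDerivWithinAt_ray (hray j)) hd0
  have hle : f' (EuclideanSpace.single k 1) ≤ 0 := by
    refine IsLocalMaxOn.hasFDerivWithinAt_nonpos (Eventually.of_forall fun y => hmax y) hf ?_
    refine mem_posTangentConeAt_of_segment_subset ?_
    rw [segment_eq_image']
    rintro _ ⟨t, ht, rfl⟩
    simpa using hray k t ht.1
  refine lt_of_le_of_ne hle fun h => hf' ?_
  refine ContinuousLinearMap.coe_injective
    ((EuclideanSpace.basisFun (Fin m) ℝ).toBasis.ext fun j => ?_)
  by_cases hj : j = k
  · simpa [hj] using h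
  · simpa using hzero j hj

/-- A non-critical point of `G` is regular from below, provided that `G` is maximal there and
locally constant along the ends if the point lies on an end, and that `G` has non-zero derivative along some
vector tangent to `Y` if it lies on `Y`. -/
theorem Cobordism.isRegularFromBelow {n : ℕ} {Ω : Type*} [TopologicalSpace Ω]
    [ChartedSpace (EuclideanQuadrant (n + 1)) Ω] (hn : 1 ≤ n) (W : Cobordism n Ω) {G : Ω → ℝ}
    (hG : ContMDiff (cornerModel n) 𝓘(ℝ, ℝ) ∞ G) {p : Ω}
    (hcrit : mfderiv (cornerModel n) 𝓘(ℝ, ℝ) G p ≠ 0)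
    (hend : p ∈ W.S₀ ∪ W.S₁ → (∀ q, G q ≤ G p) ∧ ∀ᶠ q in 𝓝 p, q ∈ W.S₀ ∪ W.S₁ → G q = G p)
    (hgrad : p ∈ W.Y → ∃ v : TangentSpace (cornerModel n) p,
      (mfderiv (cornerModel n) 𝓘(ℝ, ℝ) G p v : ℝ) ≠ 0 ∧ IsTangentAt W.Y p v) :
    IsRegularFromBelow G W.Y p := by
  obtain ⟨φ, hφ, hp, hchart⟩ := W.exists_chart p
  set x : EuclideanSpace ℝ (Fin (n + 1)) := φ.extend (cornerModel n) p with hx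
  set f := G ∘ (φ.extend (cornerModel n)).symm with hf
  set f' : EuclideanSpace ℝ (Fin (n + 1)) →L[ℝ] ℝ :=
    fderivWithin ℝ f (range (cornerModel n)) x with hf'
  -- Since `1 ≤ n`, the coordinates cutting out `Y` and the ends are different.
  have hlast : (0 : Fin (n + 1)) ≠ Fin.last n := by
    rw [Ne, Fin.ext_iff]
    simp
    omega
  have hxt : x ∈ (φ.extend (cornerModel n)).target :=
    (φ.extend (cornerModel n)).map_source (by simpa using hp)
  have hchain := mfderiv_eq_fderivWithin_extend hφ hG hp
  have hxpos : ∀ j, 0 ≤ x j := (φ p).2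
  have hx0 : p ∈ W.Y ↔ x 0 = 0 := (hchart p hp).1
  have hxl : p ∈ W.S₀ ∪ W.S₁ ↔ x (Fin.last n) = 0 := (hchart p hp).2.1
  have hxo : ∀ i, i ≠ 0 → i ≠ Fin.last n → 0 < x i := (hchart p hp).2.2
  have hsymm : ∀ y ∈ (φ.extend (cornerModel n)).target,
      (φ.extend (cornerModel n)).symm y ∈ φ.source ∧
      (φ ((φ.extend (cornerModel n)).symm y)).1 = y := fun y hy =>
    ⟨by simpa using (φ.extend (cornerModel n)).map_target hy,
      (φ.extend (cornerModel n)).right_inv hy⟩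
  obtain ⟨w, hw, hadm, hw0⟩ : ∃ w : EuclideanSpace ℝ (Fin (n + 1)), f' w < 0 ∧
      (∀ j, 0 < x j ∨ 0 ≤ w j) ∧ (p ∈ W.Y → w 0 = 0) := by
    have hf'0 : f' ≠ 0 := fun h => hcrit <| by
      ext v
      rw [hchain v]
      change f' _ = _
      rw [h]
      rfl
    have hsign : ∀ u, f' u ≠ 0 → f' u < 0 ∨ f' (-u) < 0 := fun u hu => by
      rw [map_neg, neg_lt_zero]
      exact lt_or_gt_of_ne hu
    by_cases hpS : p ∈ W.S₀ ∪ W.S₁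
    · obtain ⟨hmax, hconst⟩ := hend hpS
      have hfd : HasFDerivWithinAt f f' {y | ∀ j, 0 ≤ y j} x := by
        rw [← range_cornerModel]
        exact ((contDiffWithinAt_comp_extend_symm hφ hG hxt).differentiableWithinAt
          (by simp)).hasFDerivWithinAt
      have hfx : f x = G p := congrArg G (φ.extend_left_inv hp)
      have hneg : f' (EuclideanSpace.single (Fin.last n) 1) < 0 := by
        refine EuclideanQuadrant.fderiv_single_neg hxpos (hxl.1 hpS) hfd hf'0
          (fun y => (hmax _).trans_eq hfx.symm) ?_
        have hmap : map (φ.extend (cornerModel n)).symm (𝓝[range (cornerModel n)] x) = 𝓝 p :=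
          φ.map_extend_symm_nhdsWithin_range hp
        rw [← hmap, eventually_map] at hconst
        rw [← range_cornerModel]
        filter_upwards [hconst, φ.extend_target_mem_nhdsWithin hp] with y h1 h2 hy
        refine (h1 (((hchart _ (hsymm _ h2).1).2.1).2 ?_)).trans hfx.symm
        rw [(hsymm _ h2).2]
        exact hy
      refine ⟨EuclideanSpace.single (Fin.last n) 1, hneg, fun j => Or.inr ?_,
        fun _ => by simp [hlast]⟩
      by_cases hj : j = Fin.last n <;> simp [hj]
    · have hxl' : 0 < x (Fin.last n) := lt_of_le_of_ne (hxpos _) fun h => hpS (hxl.2 h.symm)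
      have hpos : ∀ j, j ≠ 0 → 0 < x j := fun j hj => by
        by_cases hjl : j = Fin.last n
        · exact hjl ▸ hxl'
        · exact hxo j hj hjl
      by_cases hpY : p ∈ W.Y
      · obtain ⟨v, hv, hvt⟩ := hgrad hpY
        set u : EuclideanSpace ℝ (Fin (n + 1)) :=
          mfderiv (cornerModel n) 𝓘(ℝ, EuclideanSpace ℝ (Fin (n + 1)))
            (φ.extend (cornerModel n)) p v with hu
        have hfu : f' u ≠ 0 := by
          rw [hchain v] at hv
          exact hv
        have hu0 : u 0 = 0 := by
          have h1 := ((φ.contMDiffAt_extend hφ hp).mdifferentiableAt (by simp)).hasMFDerivAt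
          have h2 := ((EuclideanSpace.proj (0 : Fin (n + 1)) :
            EuclideanSpace ℝ (Fin (n + 1)) →L[ℝ] ℝ).hasFDerivAt (x := x)).hasMFDerivAt
          have h3 := h2.comp p h1
          have h4 := hvt φ hφ hp fun q hq => (hchart q hq).1
          have h5 : mfderiv (cornerModel n) 𝓘(ℝ, ℝ) (fun q => (φ q).1 0) p = _ := h3.mfderiv
          rw [h5] at h4
          exact h4
        rcases hsign u hfu with h | h
        · exact ⟨u, h, fun j => (eq_or_ne j 0).elim (fun hj => Or.inr (by rw [hj, hu0]))
            fun hj => Or.inl (hpos j hj), fun _ => hu0⟩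
        · exact ⟨-u, h, fun j => (eq_or_ne j 0).elim (fun hj => Or.inr (by simp [hj, hu0]))
            fun hj => Or.inl (hpos j hj), fun _ => by simp [hu0]⟩
      · have hpos' : ∀ j, 0 < x j := fun j => by
          by_cases hj : j = 0
          · exact hj ▸ lt_of_le_of_ne (hxpos _) fun h => hpY (hx0.2 h.symm)
          · exact hpos j hj
        obtain ⟨u, hu⟩ : ∃ u, f' u ≠ 0 := by
          by_contra! h
          exact hf'0 (ContinuousLinearMap.ext h)
        rcases hsign u hu with h | h
        · exact ⟨u, h, fun j => Or.inl (hpos' j), fun h => absurd h hpY⟩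
        · exact ⟨-u, h, fun j => Or.inl (hpos' j), fun h => absurd h hpY⟩
  obtain ⟨τ, hτ, hev⟩ := EuclideanQuadrant.exists_eventually_add_smul_mem hadm
  rw [← range_cornerModel] at hev
  refine IsRegularFromBelow.of_chart hφ hG hp hw hτ hev fun hpY t ht => ?_
  refine ((hchart _ (hsymm _ ht).1).1).2 ?_
  rw [(hsymm _ ht).2]
  change (x + t • w) 0 = 0
  simp [hx0.1 hpY, hw0 hpY]

theorem mainTheorem12 (n : ℕ) (hn : 1 ≤ n) (Ω : Type*) [TopologicalSpace Ω] [T2Space Ω]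
    [CompactSpace Ω] [ChartedSpace (EuclideanQuadrant (n + 1)) Ω]
    [IsManifold (cornerModel n) ∞ Ω]
    (W : Cobordism n Ω) (g : SmoothMetric n Ω) (F : Ω → ℝ) (hF : IsMorseFunction W g F)
    (z : Ω) (hz : criticalSet n F = {z}) (hzY : z ∉ W.Y)
    (h₀ : NoClosedComponent W.S₀ (W.Y ∩ W.S₀))
    (h₁ : NoClosedComponent W.S₁ (W.Y ∩ W.S₁))
    (hΩ : NoClosedComponent (univ : Set Ω) ((cornerModel n).boundary Ω)) :
    (connectedComponentIn (F ⁻¹' {F z}) z ∩ W.Y).Nonempty := by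
  have hcrit : ∀ p, p ≠ z → mfderiv (cornerModel n) 𝓘(ℝ, ℝ) F p ≠ 0 := fun p hp h =>
    hp (hz ▸ (show p ∈ criticalSet n F from h) : p ∈ ({z} : Set Ω))
  have hgrad : ∀ p ∈ W.Y, p ≠ z → ∃ v : TangentSpace (cornerModel n) p,
      (mfderiv (cornerModel n) 𝓘(ℝ, ℝ) F p v : ℝ) ≠ 0 ∧ IsTangentAt W.Y p v := by
    intro p hpY hpz
    obtain ⟨v, hv, hvt⟩ := hF.gradient_tangent p hpY
    refine ⟨v, ?_, hvt⟩
    rw [← hv v]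
    refine (g.pos p v fun hv0 => hcrit p hpz ?_).ne'
    ext w
    have := hv w
    rw [hv0] at this
    exact this.symm.trans (by rw [map_zero]; rfl)
  -- Near a point of one end, a point of either end belongs to that same end.
  have hnear : ∀ {S T : Set Ω} {a : ℝ} {p : Ω}, IsClosed T → p ∉ T → (∀ q ∈ S, F q = a) →
      ∀ᶠ q in 𝓝 p, q ∈ S ∪ T → F q = a := fun hT hp h => by
    filter_upwards [hT.isOpen_compl.mem_nhds hp] with q hq hqS
    exact h q (hqS.resolve_right hq)
  refine connectedComponentIn_inter_nonempty_of_isRegular hF.smooth.continuous W.isClosed_Y ?_ ?_ ?_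
  · intro p hp
    have hpz : p ≠ z := fun h => absurd hp (by simp [h])
    refine W.isRegularFromBelow hn hF.smooth (hcrit p hpz) (fun hpS => ?_) fun h => hgrad p h hpz
    have hp0 : p ∉ W.S₀ := fun h => by
      have := (hF.mem_Icc z).1
      rw [hF.eq_zero p h] at hp
      linarith
    have hp1 := hF.eq_one p (hpS.resolve_left hp0)
    rw [hp1]
    exact ⟨fun q => (hF.mem_Icc q).2, union_comm W.S₁ W.S₀ ▸ hnear W.isClosed_S₀ hp0 hF.eq_one⟩
  · intro p hp
    have hpz : p ≠ z := fun h => absurd hp (by simp [h])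
    have hneg : mfderiv (cornerModel n) 𝓘(ℝ, ℝ) (-F) p = -mfderiv (cornerModel n) 𝓘(ℝ, ℝ) F p :=
      mfderiv_neg
    refine W.isRegularFromBelow hn (contDiff_neg.contMDiff.comp hF.smooth) ?_ (fun hpS => ?_)
      fun h => ?_
    · change mfderiv (cornerModel n) 𝓘(ℝ, ℝ) (-F) p ≠ 0
      rw [hneg]
      exact neg_ne_zero.2 (hcrit p hpz)
    · have hp1 : p ∉ W.S₁ := fun h => by
        have := (hF.mem_Icc z).2
        rw [hF.eq_one p h] at hp
        linarith
      have hp0 := hF.eq_zero p (hpS.resolve_right hp1)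
      simp only [Function.comp_apply, hp0, neg_zero, Left.neg_nonpos_iff, neg_eq_zero]
      exact ⟨fun q => (hF.mem_Icc q).1, hnear W.isClosed_S₁ hp1 hF.eq_zero⟩
    · obtain ⟨v, hv, hvt⟩ := hgrad p h hpz
      refine ⟨v, ?_, hvt⟩
      change (mfderiv (cornerModel n) 𝓘(ℝ, ℝ) (-F) p v : ℝ) ≠ 0
      rw [hneg]
      exact neg_ne_zero.2 hv
  · obtain ⟨q, hqz, hqb⟩ := hΩ z (mem_univ z)
    rw [connectedComponentIn_univ] at hqz
    have hends : ∀ S : Set Ω, NoClosedComponent S (W.Y ∩ S) → q ∈ S →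
        (connectedComponent z ∩ W.Y).Nonempty := by
      intro S hS hqS
      obtain ⟨y, hyq, hyY, -⟩ := hS q hqS
      refine ⟨y, ?_, hyY⟩
      rw [connectedComponent_eq hqz]
      exact isPreconnected_connectedComponentIn.subset_connectedComponent
        (mem_connectedComponentIn hqS) hyq
    rw [W.boundary_eq] at hqb
    rcases hqb with (hqY | hq0) | hq1
    · exact ⟨q, hqz, hqY⟩
    · exact hends _ h₀ hq0
    · exact hends _ h₁ hq1
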